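/- Let $n\ge 3$ and $m\ge 0$ be integers, $\rho>0$, and let $$p(\theta)=\rho+\sum_{k=0}^{m}\bigl(a_{kn+1}\cos((kn+1)\theta)+b_{kn+1}\sin((kn+1)\theta)+a_{kn-1}\cos((kn-1)\theta)+b_{kn-1}\sin((kn-1)\theta)\bigr)$$ be a trigonometric polynomial with real coefficients such that $p(\theta)+p''(\theta)\ge 0$ for all $\theta\in\mathbb R$. Let $\mathcal C\subset\mathbb R^2$ be the algebraic rotor of a regular $n$-gon with apothem $\rho$ that has $p$ as support function, that is, the curve $$\mathcal C=\bigl\{\bigl(p(\theta)\cos\theta-p'(\theta)\sin\theta,\ p(\theta)\sin\theta+p'(\theta)\cos\theta\bigr):\theta\in[-\pi,\pi]\bigr\}.$$ Assume that $\mathcal C$ is not a circle and that $a_{nm+1}\ne 0$ or $b_{nm+1}\ne 0$. Then $\mathcal C$ has a defining polynomial, i.e. an irreducible polynomial $f\in\mathbb R[x,y]$ such that the polynomials in $\mathbb R[x,y]$ vanishing on $\mathcal C$ are exactly the multiples of $f$ (so $f$ is unique up to a nonzero constant factor), and every such $f$ has total degree $2nm+4$ and satisfies $\deg_x f=\deg_y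 f=2nm+4$. -/

import Mathlib

open MvPolynomial

noncomputable section

/-- The map `θ ↦ γ(θ) = (p(θ) cos θ - p'(θ) sin θ, p(θ) sin θ + p'(θ) cos θ)`. -/
def supportParam (p : ℝ → ℝ) (θ : ℝ) : Fin 2 → ℝ :=
  ![p θ * Real.cos θ - deriv p θ * Real.sin θ,
    p θ * Real.sin θ + deriv p θ * Real.cos θ]

/-- The closed plane curve (as a set of points) described by `γ` on `[-π, π]`. -/
def supportCurve (p : ℝ → ℝ) : Set (Fin 2 → ℝ) :=
  supportParam p '' Set.Icc (-Real.pi) Real.pi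

/-- The trigonometric polynomial with constant term `ρ` and harmonics of order `k n ± 1`,
`0 ≤ k ≤ m`. The coefficient families are indexed by `ℤ` because the order `k n - 1` is `-1`
for `k = 0`; that term is just another harmonic of order one. -/
def rotorSupport (n m : ℕ) (ρ : ℝ) (a b : ℤ → ℝ) (θ : ℝ) : ℝ :=
  ρ + ∑ k ∈ Finset.range (m + 1),
    (a ((k : ℤ) * n + 1) * Real.cos (((k : ℝ) * n + 1) * θ)
      + b ((k : ℤ) * n + 1) * Real.sin (((k : ℝ) * n + 1) * θ)
      + a ((k : ℤ) * n - 1) * Real.cos (((k : ℝ) * n - 1) * θ)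
      + b ((k : ℤ) * n - 1) * Real.sin (((k : ℝ) * n - 1) * θ))

/-- `C` is an algebraic rotor of a regular `n`-gon with apothem `ρ`, with support function
`p = rotorSupport n m ρ a b`; the convexity condition is `p + p'' ≥ 0`. -/
structure IsAlgebraicRotor (n m : ℕ) (ρ : ℝ) (a b : ℤ → ℝ) (C : Set (Fin 2 → ℝ)) : Prop where
  three_le : 3 ≤ n
  apothem_pos : 0 < ρ
  curve_eq : C = supportCurve (rotorSupport n m ρ a b)
  convex : ∀ θ : ℝ,
    0 ≤ rotorSupport n m ρ a b θ + deriv (deriv (rotorSupport n m ρ a b)) θ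

/-- `C` is a Euclidean circle of positive radius. -/
def IsCircle (C : Set (Fin 2 → ℝ)) : Prop :=
  ∃ (c : Fin 2 → ℝ) (r : ℝ), 0 < r ∧
    C = {P : Fin 2 → ℝ | (P 0 - c 0) ^ 2 + (P 1 - c 1) ^ 2 = r ^ 2}

/-- `f` is a defining polynomial of the plane curve `C`: it is irreducible, and the
polynomials that vanish on `C` are exactly the multiples of `f`. The variables `x`, `y` are
`X 0`, `X 1`. -/
structure IsDefiningPolynomial (C : Set (Fin 2 → ℝ)) (f : MvPolynomial (Fin 2) ℝ) : Prop where
  irreducible : Irreducible f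
  vanishingIdeal_eq : vanishingIdeal ℝ C = Ideal.span {f}

end

/-! Put `z = exp (i θ)` and `N = n m + 1`. The coordinates of the curve are Laurent polynomials `X`,
`Y` in `z`, and the vanishing ideal is the kernel of `f ↦ f(X, Y)`, hence prime. It meets `ℝ[y]`
only in zero because `Y` is transcendental, so any irreducible element generates it
(`eq_span_singleton_of_irreducible_mem`).

The ideal is nonzero and `deg f ≤ 2 (N + 1)` by comparing dimensions: polynomials of degree at most
`d` restrict to trigonometric polynomials of degree at most `d (N + 1)`, a space of dimension at
most `2 d (N + 1) + 1` (`exists_ne_zero_map_eq_zero`, `totalDegree_le_of_ker`).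

For the lower bound, the extreme exponents of `X` and `Y` are `±(N + 1)`, so `ℂ(z)` has degree `2 (N
+ 1)` over `ℂ(X)` and over `ℂ(Y)` (`finrank_adjoin_toRatFunc`). If `ℂ(X, Y) = ℂ(z)`, these degrees
bound `deg_y f` and `deg_x f` from below (`two_mul_le_degreeOf`). Birationality is
`adjoin_curve_eq_top`: the gradient of `f` is parallel to the normal `(cos θ, sin θ)`, so `z ^ 2` is
rational in `X, Y`; then `X + i Y = z (p + i p')` has a nonzero odd part, since its coefficient at
`z` is the mean `ρ`, and this yields `z`.

A rotor that is not a circle has `m ≠ 0`, so `N ≥ 2`, which keeps the extreme coefficients of `X`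
and `Y` from vanishing. -/

/-! ### Principality of ideals with zero contraction -/

/-- If `f` did not divide some `h` in `I`, Gauss's lemma would make them coprime over the fraction
field, and their resultant would be a nonzero constant lying in `I`. -/
theorem Polynomial.eq_span_singleton_of_comap_C_eq_bot {R : Type*} [CommRing R] [IsDomain R]
    [UniqueFactorizationMonoid R] {I : Ideal (Polynomial R)}
    (hI : ∀ c : R, Polynomial.C c ∈ I → c = 0) {f : Polynomial R} (hf : Irreducible f)
    (hfI : f ∈ I) : I = Ideal.span {f} := by
  have hdeg : f.natDegree ≠ 0 := by
    intro h
    obtain ⟨c, rfl⟩ := Polynomial.natDegree_eq_zero.1 h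
    exact hf.ne_zero (by rw [hI c hfI, map_zero])
  have hprim : f.IsPrimitive := hf.isPrimitive hdeg
  let K := FractionRing R
  have hirr : Irreducible (f.map (algebraMap R K)) :=
    (hprim.irreducible_iff_irreducible_map_fraction_map (K := K)).1 hf
  have hinj : Function.Injective (algebraMap R K) := IsFractionRing.injective R K
  refine le_antisymm (fun h hh => ?_) ((Ideal.span_singleton_le_iff_mem I).2 hfI)
  rw [Ideal.mem_span_singleton]
  by_contra hndvd
  have hcop : IsCoprime (f.map (algebraMap R K)) (h.map (algebraMap R K)) :=
    hirr.coprime_iff_not_dvd.2 fun hd =>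
      hndvd (hprim.dvd_of_fraction_map_dvd_fraction_map (K := K) hd)
  have hres : f.resultant h ≠ 0 := by
    have h1 := Polynomial.resultant_ne_zero _ _ hcop
    rw [Polynomial.natDegree_map_eq_of_injective hinj, Polynomial.natDegree_map_eq_of_injective hinj,
      Polynomial.resultant_map_map] at h1
    exact fun h0 => h1 (by rw [h0, map_zero])
  obtain ⟨p, q, -, -, hpq⟩ :=
    Polynomial.exists_mul_add_mul_eq_C_resultant f h le_rfl le_rfl (Or.inl hdeg)
  exact hres (hI _ (hpq ▸ I.add_mem (I.mul_mem_right _ hfI) (I.mul_mem_right _ hh)))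

theorem MvPolynomial.eq_span_singleton_of_irreducible_mem {k : Type*} [Field k]
    {I : Ideal (MvPolynomial (Fin 2) k)}
    (hI : ∀ c : MvPolynomial (Fin 1) k, rename Fin.succ c ∈ I → c = 0)
    {f : MvPolynomial (Fin 2) k} (hf : Irreducible f) (hfI : f ∈ I) : I = Ideal.span {f} := by
  let e := finSuccEquiv k 1
  have hC : ∀ c : MvPolynomial (Fin 1) k, e.symm (Polynomial.C c) = rename Fin.succ c := by
    intro c
    rw [AlgEquiv.symm_apply_eq]
    induction c using MvPolynomial.induction_on with
    | C a => simp [e, finSuccEquiv_apply]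
    | add p q hp hq => simp only [map_add, hp, hq]
    | mul_X p i hp =>
      rw [map_mul, map_mul, map_mul, hp, rename_X]
      simp only [e, finSuccEquiv_X_succ]
  have h := Polynomial.eq_span_singleton_of_comap_C_eq_bot (I := I.comap (e.symm : _ →+* _))
    (f := e f) (fun c hc => hI c (by rw [← hC]; exact hc))
    ((MulEquiv.irreducible_iff e).2 hf) (by simpa [Ideal.mem_comap] using hfI)
  ext g
  have hg : g ∈ I ↔ e g ∈ I.comap (e.symm : _ →+* _) := by simp [Ideal.mem_comap]
  rw [hg, h, Ideal.mem_span_singleton, Ideal.mem_span_singleton]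
  exact map_dvd_iff e

/-! ### Field degrees as lower bounds for partial degrees -/

/-- Substituting `t` for the second variable turns `h` into a polynomial over `k(t)` with root `s`,
nonzero because `t` is transcendental. The minimal polynomial of the generator `s` divides it. -/
theorem MvPolynomial.finrank_le_degreeOf_zero {k K : Type*} [Field k] [Field K] [Algebra k K]
    {s t : K} (ht : Transcendental k t) (hst : IntermediateField.adjoin k {s, t} = ⊤)
    {h : MvPolynomial (Fin 2) k} (h0 : h ≠ 0) (hh : aeval ![s, t] h = 0) :
    Module.finrank (IntermediateField.adjoin k {t}) K ≤ degreeOf 0 h := by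
  set F := IntermediateField.adjoin k {t} with hF
  let t' : F := ⟨t, IntermediateField.mem_adjoin_simple_self k t⟩
  let ψ : MvPolynomial (Fin 1) k →ₐ[k] F := aeval fun _ => t'
  have hψ : Function.Injective ψ := by
    have h1 : AlgebraicIndependent k (fun _ : Fin 1 => t') := by
      rw [algebraicIndependent_unique_type_iff]
      intro halg
      exact ht (halg.algebraMap (A := K))
    exact h1
  set g : Polynomial F := (finSuccEquiv k 1 h).map ψ.toRingHom with hg
  have hg0 : g ≠ 0 := by
    rw [hg, Ne, Polynomial.map_eq_zero_iff hψ]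
    simpa using h0
  have hroot : Polynomial.aeval s g = 0 := by
    rw [hg, Polynomial.aeval_def, Polynomial.eval₂_map, ← hh]
    have : (Polynomial.eval₂RingHom ((algebraMap F K).comp ψ.toRingHom) s).comp
        (finSuccEquiv k 1).toRingEquiv.toRingHom
        = (aeval ![s, t] : MvPolynomial (Fin 2) k →ₐ[k] K).toRingHom := by
      apply MvPolynomial.ringHom_ext
      · intro r
        simp [finSuccEquiv_apply]
      · intro i
        refine Fin.cases ?_ (fun j => ?_) i
        · simp [finSuccEquiv_X_zero]
        · have : j = 0 := Subsingleton.elim _ _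
          subst this
          change Polynomial.eval₂ _ s (finSuccEquiv k 1 (X (Fin.succ 0)))
            = aeval ![s, t] (X (Fin.succ 0))
          rw [finSuccEquiv_X_succ]
          simp [ψ, t']
    exact DFunLike.congr_fun this h
  have halg : IsAlgebraic F s := ⟨g, hg0, hroot⟩
  have hs : IsIntegral F s := halg.isIntegral
  have htop : IntermediateField.adjoin F {s} = ⊤ := by
    rw [← IntermediateField.restrictScalars_eq_top_iff (K := k),
      IntermediateField.restrictScalars_adjoin, eq_top_iff, ← hst]
    refine IntermediateField.adjoin.mono _ _ _ ?_
    rintro x (rfl | hx)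
    · exact Or.inr rfl
    · rw [Set.mem_singleton_iff.1 hx]
      exact Or.inl t'.2
  calc Module.finrank F K = Module.finrank F (IntermediateField.adjoin F {s}) := by
        rw [htop, IntermediateField.finrank_top']
    _ = (minpoly F s).natDegree := IntermediateField.adjoin.finrank hs
    _ ≤ g.natDegree := Polynomial.natDegree_le_of_dvd (minpoly.dvd F s hroot) hg0
    _ ≤ (finSuccEquiv k 1 h).natDegree := Polynomial.natDegree_map_le
    _ = degreeOf 0 h := natDegree_finSuccEquiv h

/-! ### Dimension counts for plane curves -/

theorem MvPolynomial.two_mul_finrank_restrictTotalDegree (k : Type*) [Field k] (d : ℕ) :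
    2 * Module.finrank k (restrictTotalDegree (Fin 2) k d) = (d + 1) * (d + 2) := by
  have hcard : Module.finrank k (restrictTotalDegree (Fin 2) k d)
      = Nat.card {n : Fin 2 →₀ ℕ | (n.sum fun _ e => e) ≤ d} :=
    Module.finrank_eq_nat_card_basis (basisRestrictSupport k _)
  let e : {n : Fin 2 →₀ ℕ | (n.sum fun _ e => e) ≤ d} ≃
      (Finset.range (d + 1)).sigma fun s => Finset.HasAntidiagonal.antidiagonal s :=
    { toFun := fun n => ⟨⟨n.1 0 + n.1 1, (n.1 0, n.1 1)⟩, by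
        have := n.2
        simp [Finsupp.sum_fintype] at this ⊢
        omega⟩
      invFun := fun x => ⟨Finsupp.equivFunOnFinite.symm ![x.1.2.1, x.1.2.2], by
        obtain ⟨⟨s, a, b⟩, hx⟩ := x
        simp [Finsupp.sum_fintype] at hx ⊢
        omega⟩
      left_inv := fun n => by
        ext i
        fin_cases i <;> simp
      right_inv := fun x => by
        obtain ⟨⟨s, a, b⟩, hx⟩ := x
        simp at hx
        obtain ⟨h1, rfl⟩ := hx
        simp }
  rw [hcard, Nat.card_congr e, Nat.card_eq_fintype_card, Fintype.card_coe, Finset.card_sigma]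
  simp only [Finset.Nat.card_antidiagonal]
  clear hcard e
  induction d with
  | zero => simp
  | succ d ih => rw [Finset.sum_range_succ, mul_add, ih]; ring

section HilbertFunction

variable {k V : Type*} [Field k] [AddCommGroup V] [Module k V]

/-- Rank-nullity for the restriction of a linear map to the polynomials of degree at most `d`. -/
theorem MvPolynomial.finrank_restrictTotalDegree_le (φ : MvPolynomial (Fin 2) k →ₗ[k] V)
    (W : Submodule k V) [FiniteDimensional k W] (d : ℕ)
    (hW : ∀ g : MvPolynomial (Fin 2) k, g.totalDegree ≤ d → φ g ∈ W)
    (U : Submodule k (MvPolynomial (Fin 2) k)) [FiniteDimensional k U]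
    (hU : ∀ g : MvPolynomial (Fin 2) k, g.totalDegree ≤ d → φ g = 0 → g ∈ U) :
    Module.finrank k (restrictTotalDegree (Fin 2) k d)
      ≤ Module.finrank k W + Module.finrank k U := by
  let ψ : restrictTotalDegree (Fin 2) k d →ₗ[k] W :=
    (φ.comp (restrictTotalDegree (Fin 2) k d).subtype).codRestrict W
      fun g => hW g.1 ((mem_restrictTotalDegree _ _ _).1 g.2)
  have hker : Module.finrank k (LinearMap.ker ψ) ≤ Module.finrank k U := by
    let ι : LinearMap.ker ψ →ₗ[k] U :=
      ((restrictTotalDegree (Fin 2) k d).subtype.comp (LinearMap.ker ψ).subtype).codRestrict U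
        fun g => hU g.1.1 ((mem_restrictTotalDegree _ _ _).1 g.1.2)
          (congrArg Subtype.val (LinearMap.mem_ker.1 g.2))
    refine LinearMap.finrank_le_finrank_of_injective (f := ι) fun a b hab => ?_
    exact Subtype.ext (Subtype.ext (congrArg (fun x : U => (x : MvPolynomial (Fin 2) k)) hab))
  rw [← LinearMap.finrank_range_add_finrank_ker ψ]
  exact add_le_add (Submodule.finrank_le _) hker

/-- The source grows quadratically in `d` and the target only linearly, so `φ` cannot be injective.
-/
theorem MvPolynomial.exists_ne_zero_map_eq_zero (φ : MvPolynomial (Fin 2) k →ₗ[k] V) (D : ℕ)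
    (W : ℕ → Submodule k V) [∀ d, FiniteDimensional k (W d)]
    (hWrank : ∀ d, Module.finrank k (W d) ≤ d * D + 1)
    (hW : ∀ d, ∀ g : MvPolynomial (Fin 2) k, g.totalDegree ≤ d → φ g ∈ W d) :
    ∃ g, g ≠ 0 ∧ φ g = 0 := by
  by_contra! hcon
  -- In degree `2 D + 1` the source has dimension `(D + 1) (2 D + 3)`, more than `(2 D + 1) D + 1`.
  have h := finrank_restrictTotalDegree_le φ (W (2 * D + 1)) (2 * D + 1) (hW _) ⊥
    (fun g _ hg => (Submodule.mem_bot k).2 (by_contra fun h0 => hcon g h0 hg))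
  have h1 := two_mul_finrank_restrictTotalDegree k (2 * D + 1)
  have h2 := hWrank (2 * D + 1)
  rw [finrank_bot] at h
  nlinarith

/-- Modulo multiples of `f`, the polynomials of degree at most `d` have dimension growing like `d *
deg f`, and they inject into a space of dimension at most `d * D + 1`. -/
theorem MvPolynomial.totalDegree_le_of_ker (φ : MvPolynomial (Fin 2) k →ₗ[k] V) (D : ℕ)
    (W : ℕ → Submodule k V) [∀ d, FiniteDimensional k (W d)]
    (hWrank : ∀ d, Module.finrank k (W d) ≤ d * D + 1)
    (hW : ∀ d, ∀ g : MvPolynomial (Fin 2) k, g.totalDegree ≤ d → φ g ∈ W d)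
    {f : MvPolynomial (Fin 2) k} (hf : f ≠ 0) (hker : ∀ g, φ g = 0 → f ∣ g) :
    f.totalDegree ≤ D := by
  set e := f.totalDegree with he
  -- The count in degree `e + t` reads `e (2 t + e + 3) ≤ 2 (e + t) D + 2`. If `e ≥ D + 1`, the left
  -- side exceeds `2 t D + 2 t`, and `2 t = 2 e D + 2` already accounts for the rest of the right
  -- side.
  set t := e * D + 1 with ht
  let U : Submodule k (MvPolynomial (Fin 2) k) :=
    (restrictTotalDegree (Fin 2) k t).map (LinearMap.mulLeft k f)
  have hU : Module.finrank k U ≤ Module.finrank k (restrictTotalDegree (Fin 2) k t) :=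
    Submodule.finrank_map_le _ _
  have h := finrank_restrictTotalDegree_le φ (W (e + t)) (e + t) (hW _) U ?_
  · have h1 := two_mul_finrank_restrictTotalDegree k (e + t)
    have h2 := two_mul_finrank_restrictTotalDegree k t
    have h3 := hWrank (e + t)
    by_contra! hlt
    nlinarith
  · intro g hg hg0
    obtain ⟨q, rfl⟩ := hker g hg0
    refine ⟨q, ?_, rfl⟩
    rw [SetLike.mem_coe, mem_restrictTotalDegree]
    rcases eq_or_ne q 0 with rfl | hq
    · simp
    · rw [totalDegree_mul_of_isDomain hf hq] at hg
      omega

end HilbertFunction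

/-! ### Laurent polynomials on the circle and as rational functions -/

open scoped LaurentPolynomial

noncomputable section

namespace LaurentPolynomial

/-- Evaluation of a complex Laurent polynomial at the point `exp (i θ)` of the unit circle. -/
def evalCircle (θ : ℝ) : ℂ[T;T⁻¹] →+* ℂ :=
  eval₂ (RingHom.id ℂ) (Units.mk0 (Complex.exp (θ * Complex.I)) (Complex.exp_ne_zero _))

theorem evalCircle_T (θ : ℝ) (j : ℤ) :
    evalCircle θ (T j) = Complex.exp (j * (θ * Complex.I)) := by
  rw [evalCircle, eval₂_T, Units.val_zpow_eq_zpow_val, Units.val_mk0, ← Complex.exp_int_mul]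

theorem evalCircle_C (θ : ℝ) (c : ℂ) : evalCircle θ (C c) = c := by
  simp [evalCircle]

/-- After clearing the pole at zero this is a polynomial with infinitely many roots on the unit
circle. -/
theorem eq_zero_of_evalCircle {q : ℂ[T;T⁻¹]}
    (hq : ∀ θ ∈ Set.Icc (-Real.pi) Real.pi, evalCircle θ q = 0) : q = 0 := by
  obtain ⟨n, g, hg⟩ := exists_T_pow q
  have hroot : ∀ θ ∈ Set.Icc (-Real.pi) Real.pi, g.eval (Complex.exp (θ * Complex.I)) = 0 := by
    intro θ hθ
    have h := congrArg (evalCircle θ) hg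
    rw [map_mul, hq θ hθ, zero_mul, evalCircle, eval₂_toLaurent] at h
    simpa [Polynomial.eval₂_id] using h
  have hg0 : g = 0 := by
    refine Polynomial.eq_zero_of_infinite_isRoot g (Set.Infinite.mono
      (s := (fun θ : ℝ => Complex.exp (θ * Complex.I)) '' Set.Ioc (-Real.pi) Real.pi) ?_ ?_)
    · rintro _ ⟨θ, hθ, rfl⟩
      exact hroot θ ⟨hθ.1.le, hθ.2⟩
    · refine (Set.Ioc_infinite (by linarith [Real.pi_pos])).image ?_
      intro s hs t ht hst
      have h := congrArg Complex.arg hst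
      simp only [Complex.arg_exp_mul_I] at h
      rwa [(toIocMod_eq_self Real.two_pi_pos).2 ⟨hs.1, by linarith [hs.2]⟩,
        (toIocMod_eq_self Real.two_pi_pos).2 ⟨ht.1, by linarith [ht.2]⟩] at h
  rw [hg0, map_zero] at hg
  exact (isUnit_T (n : ℤ)).mul_left_eq_zero.1 hg.symm

/-- The embedding of the Laurent polynomials into the field of rational functions. -/
def toRatFunc : ℂ[T;T⁻¹] →+* RatFunc ℂ :=
  eval₂ (algebraMap ℂ (RatFunc ℂ)) (Units.mk0 RatFunc.X RatFunc.X_ne_zero)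

theorem toRatFunc_T (j : ℤ) : toRatFunc (T j) = RatFunc.X ^ j := by
  simp [toRatFunc]

theorem toRatFunc_C (c : ℂ) : toRatFunc (C c) = algebraMap ℂ (RatFunc ℂ) c := by
  simp [toRatFunc]

theorem toRatFunc_toLaurent (g : Polynomial ℂ) :
    toRatFunc (Polynomial.toLaurent g) = algebraMap (Polynomial ℂ) (RatFunc ℂ) g := by
  rw [toRatFunc, eval₂_toLaurent, Units.val_mk0, ← Polynomial.aeval_def,
    RatFunc.aeval_X_left_eq_algebraMap]

theorem toRatFunc_injective : Function.Injective toRatFunc := by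
  rw [injective_iff_map_eq_zero]
  intro q hq
  obtain ⟨n, g, hg⟩ := exists_T_pow q
  have h := congrArg toRatFunc hg
  rw [map_mul, hq, zero_mul, toRatFunc_toLaurent] at h
  rw [(map_eq_zero_iff _ (RatFunc.algebraMap_injective ℂ)).1 h, map_zero] at hg
  exact (isUnit_T (n : ℤ)).mul_left_eq_zero.1 hg.symm

theorem coeff_C_mul_T (a : ℂ) (n j : ℤ) :
    (C a * T n : ℂ[T;T⁻¹]).coeff j = if n = j then a else 0 := by
  rw [← single_eq_C_mul_T, AddMonoidAlgebra.coeff_single, Finsupp.single_apply]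

theorem coeff_C_mul (a : ℂ) (q : ℂ[T;T⁻¹]) (j : ℤ) : (C a * q).coeff j = a * q.coeff j := by
  rw [← smul_eq_C_mul]; rfl

theorem coeff_mul_T (q : ℂ[T;T⁻¹]) (n j : ℤ) : (q * T n).coeff j = q.coeff (j - n) := by
  induction q using LaurentPolynomial.induction_on' with
  | add p q hp hq => simp [add_mul, hp, hq]
  | C_mul_T k a =>
    rw [mul_assoc, ← T_add, coeff_C_mul_T, coeff_C_mul_T]
    congr 1
    exact propext ⟨fun h => by omega, fun h => by omega⟩

/-- The derivative with respect to the angle of the trigonometric polynomial attached to `q`. -/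
theorem exists_hasDerivAt_evalCircle (q : ℂ[T;T⁻¹]) :
    ∃ r : ℂ[T;T⁻¹], (∀ j, r.coeff j = j * Complex.I * q.coeff j) ∧
      ∀ θ : ℝ, HasDerivAt (fun t : ℝ => evalCircle t q) (evalCircle θ r) θ := by
  induction q using LaurentPolynomial.induction_on' with
  | add p q hp hq =>
    obtain ⟨r, hr, hr'⟩ := hp
    obtain ⟨s, hs, hs'⟩ := hq
    refine ⟨r + s, fun j => ?_, fun θ => ?_⟩
    · simp [hr, hs, mul_add]
    · simp only [map_add]
      exact (hr' θ).add (hs' θ)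
  | C_mul_T n a =>
    refine ⟨C (n * Complex.I * a) * T n, fun j => ?_, fun θ => ?_⟩
    · rw [coeff_C_mul_T, coeff_C_mul_T]
      split_ifs with h
      · rw [h]
      · simp
    · simp only [map_mul, evalCircle_C, evalCircle_T]
      have h1 : HasDerivAt (fun t : ℝ => (n : ℂ) * ((t : ℂ) * Complex.I)) (n * (1 * Complex.I)) θ :=
        ((Complex.ofRealCLM.hasDerivAt (x := θ)).mul_const Complex.I).const_mul _
      convert! (h1.cexp.const_mul a) using 1
      ring

/-- If a field contains the square of the variable, then every Laurent polynomial splits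
over that field into an even and an odd part. -/
theorem exists_even_odd {S : IntermediateField ℂ (RatFunc ℂ)} (hS : RatFunc.X ^ 2 ∈ S)
    (q : ℂ[T;T⁻¹]) : ∃ e o : ℂ[T;T⁻¹], toRatFunc e ∈ S ∧ toRatFunc o ∈ S ∧
      q = e + T 1 * o ∧ o.coeff 0 = q.coeff 1 := by
  have key : ∀ (a : ℂ) (k : ℤ), toRatFunc (C a * T (k + k)) ∈ S := by
    intro a k
    rw [map_mul, toRatFunc_C, toRatFunc_T, ← two_mul, zpow_mul]
    exact mul_mem (S.algebraMap_mem a) (zpow_mem hS k)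
  induction q using LaurentPolynomial.induction_on' with
  | add p q hp hq =>
    obtain ⟨e, o, he, ho, h, hc⟩ := hp
    obtain ⟨e', o', he', ho', h', hc'⟩ := hq
    refine ⟨e + e', o + o', ?_, ?_, ?_, ?_⟩
    · rw [map_add]; exact add_mem he he'
    · rw [map_add]; exact add_mem ho ho'
    · rw [h, h']; ring
    · simp [hc, hc']
  | C_mul_T n a =>
    obtain ⟨k, rfl⟩ | ⟨k, rfl⟩ := Int.even_or_odd n
    · refine ⟨C a * T (k + k), 0, key a k, by simp, by simp, ?_⟩
      rw [coeff_C_mul_T, if_neg (by omega)]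
      simp
    · refine ⟨0, C a * T (k + k), by simp, key a k, ?_, ?_⟩
      · rw [mul_left_comm, ← T_add, zero_add]
        ring_nf
      · rw [coeff_C_mul_T, coeff_C_mul_T]
        congr 1
        exact propext ⟨fun h => by omega, fun h => by omega⟩

theorem exists_toLaurent_eq_mul_T {q : ℂ[T;T⁻¹]} {M : ℕ}
    (hq : ∀ j : ℤ, (M : ℤ) < |j| → q.coeff j = 0) :
    ∃ g : Polynomial ℂ, Polynomial.toLaurent g = q * T M ∧ g.natDegree ≤ 2 * M ∧
      ∀ i : ℕ, i ≤ 2 * M → g.coeff i = q.coeff (i - M) := by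
  refine ⟨∑ i ∈ Finset.range (2 * M + 1), Polynomial.monomial i (q.coeff ((i : ℤ) - M)),
    ?_, ?_, ?_⟩
  · ext j
    rw [coeff_mul_T, map_sum]
    simp only [← Polynomial.C_mul_X_pow_eq_monomial, Polynomial.toLaurent_C_mul_X_pow,
      AddMonoidAlgebra.coeff_sum, Finsupp.finsetSum_apply, coeff_C_mul_T]
    by_cases hj : 0 ≤ j ∧ j ≤ 2 * M
    · rw [Finset.sum_eq_single j.toNat]
      · rw [if_pos (by omega)]
        congr 2
        omega
      · intro b _ hb
        rw [if_neg (by omega)]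
      · intro h
        exact absurd (Finset.mem_range.2 (by omega)) h
    · rw [Finset.sum_eq_zero, hq]
      · rw [lt_abs]; omega
      · intro i hi
        rw [Finset.mem_range] at hi
        rw [if_neg (by omega)]
  · refine Polynomial.natDegree_sum_le_of_forall_le _ _ fun i hi => ?_
    exact (Polynomial.natDegree_monomial_le _).trans (by rw [Finset.mem_range] at hi; omega)
  · intro i hi
    rw [Polynomial.finsetSum_coeff]
    simp only [Polynomial.coeff_monomial]
    rw [Finset.sum_ite_eq' , if_pos (Finset.mem_range.2 (by omega))]

/-- A Laurent polynomial with extreme exponents `-M` and `M` has degree `2 M` as a rational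
function. -/
theorem finrank_adjoin_toRatFunc {q : ℂ[T;T⁻¹]} {M : ℕ}
    (hq : ∀ j : ℤ, (M : ℤ) < |j| → q.coeff j = 0) (htop : q.coeff M ≠ 0)
    (hbot : q.coeff (-M) ≠ 0) :
    Module.finrank (IntermediateField.adjoin ℂ {toRatFunc q}) (RatFunc ℂ) = 2 * M := by
  obtain ⟨g, hg, hdeg, hcoeff⟩ := exists_toLaurent_eq_mul_T hq
  have hdeg : g.natDegree = 2 * M := by
    refine le_antisymm hdeg (Polynomial.le_natDegree_of_ne_zero ?_)
    rw [hcoeff _ le_rfl]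
    convert htop using 2
    push_cast; ring
  -- The nonzero lowest coefficient makes `g / X ^ M` a reduced fraction, so the numerator keeps the
  -- full degree `2 M`.
  have hcop : IsCoprime g (Polynomial.X ^ M) := by
    refine IsCoprime.pow_right ?_
    refine ((Polynomial.irreducible_X.coprime_iff_not_dvd).2 ?_).symm
    rw [Polynomial.X_dvd_iff, hcoeff 0 (by omega)]
    simpa using hbot
  set f := toRatFunc q with hf
  have hX : (algebraMap (Polynomial ℂ) (RatFunc ℂ)) (Polynomial.X ^ M) ≠ 0 := by
    simp [RatFunc.X_ne_zero]
  have hfg : algebraMap (Polynomial ℂ) (RatFunc ℂ) g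
      = f * algebraMap (Polynomial ℂ) (RatFunc ℂ) (Polynomial.X ^ M) := by
    have h := congrArg toRatFunc hg
    rw [toRatFunc_toLaurent, map_mul, toRatFunc_T] at h
    rw [h]; simp [hf]
  have hmul : f.num * Polynomial.X ^ M = g * f.denom := by
    apply RatFunc.algebraMap_injective ℂ
    rw [map_mul, map_mul, hfg]
    nth_rw 2 [← RatFunc.num_div_denom f]
    field_simp [RatFunc.algebraMap_ne_zero f.denom_ne_zero]
  have hg0 : g ≠ 0 := by
    rintro rfl
    rw [Polynomial.natDegree_zero] at hdeg
    have := hcoeff 0 (by omega)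
    exact hbot (by simpa using this.symm)
  have hnum0 : f.num ≠ 0 := by
    intro h
    rw [h, zero_mul] at hmul
    exact (mul_ne_zero hg0 f.denom_ne_zero) hmul.symm
  have h1 : f.num.natDegree = 2 * M := by
    rw [← hdeg]
    refine le_antisymm (Polynomial.natDegree_le_of_dvd ?_ hg0)
      (Polynomial.natDegree_le_of_dvd ?_ hnum0)
    · exact f.isCoprime_num_denom.dvd_of_dvd_mul_right (Dvd.intro _ hmul)
    · exact hcop.dvd_of_dvd_mul_right (Dvd.intro _ hmul.symm)
  have h2 : f.denom.natDegree ≤ M := by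
    have h : f.denom ∣ Polynomial.X ^ M :=
      f.isCoprime_num_denom.symm.dvd_of_dvd_mul_left (Dvd.intro_left _ hmul.symm)
    simpa using Polynomial.natDegree_le_of_dvd h (pow_ne_zero _ Polynomial.X_ne_zero)
  rw [RatFunc.finrank_eq_max_natDegree, h1]
  omega

end LaurentPolynomial

/-! ### Real trigonometric polynomials and bounded exponents -/

open Classical in
/-- The cosines of order at most `k` and the sines of positive order at most `k`. -/
def trigFinset (k : ℕ) : Finset (ℝ → ℝ) :=
  (Finset.range (k + 1)).image (fun (j : ℕ) (θ : ℝ) => Real.cos (j * θ)) ∪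
    (Finset.range k).image (fun (j : ℕ) (θ : ℝ) => Real.sin (((j + 1 : ℕ) : ℝ) * θ))

/-- The real trigonometric polynomials of degree at most `k`. -/
def trigSpan (k : ℕ) : Submodule ℝ (ℝ → ℝ) :=
  Submodule.span ℝ (trigFinset k : Set (ℝ → ℝ))

instance (k : ℕ) : FiniteDimensional ℝ (trigSpan k) :=
  FiniteDimensional.span_finset ℝ _

theorem finrank_trigSpan_le (k : ℕ) : Module.finrank ℝ (trigSpan k) ≤ 2 * k + 1 := by
  classical
  refine (finrank_span_finset_le_card _).trans ?_
  refine (Finset.card_union_le _ _).trans ?_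
  have h1 := Finset.card_image_le (s := Finset.range (k + 1))
    (f := fun (j : ℕ) (θ : ℝ) => Real.cos (j * θ))
  have h2 := Finset.card_image_le (s := Finset.range k)
    (f := fun (j : ℕ) (θ : ℝ) => Real.sin (((j + 1 : ℕ) : ℝ) * θ))
  rw [Finset.card_range] at h1 h2
  convert (add_le_add h1 h2).trans (by omega : k + 1 + k ≤ 2 * k + 1) using 3

theorem cos_int_mem_trigSpan {k : ℕ} {j : ℤ} (hj : |j| ≤ k) :
    (fun θ : ℝ => Real.cos (j * θ)) ∈ trigSpan k := by
  classical
  have hnat : ∀ i : ℕ, i ≤ k → (fun θ : ℝ => Real.cos (i * θ)) ∈ trigSpan k := fun i hi =>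
    Submodule.subset_span (Finset.mem_coe.2 (Finset.mem_union_left _
      (Finset.mem_image_of_mem _ (Finset.mem_range.2 (by omega)))))
  obtain ⟨i, rfl | rfl⟩ := j.eq_nat_or_neg
  · simpa using hnat i (by simpa using hj)
  · simpa using hnat i (by simpa using hj)

theorem sin_int_mem_trigSpan {k : ℕ} {j : ℤ} (hj : |j| ≤ k) :
    (fun θ : ℝ => Real.sin (j * θ)) ∈ trigSpan k := by
  classical
  have hnat : ∀ i : ℕ, i ≤ k → (fun θ : ℝ => Real.sin (i * θ)) ∈ trigSpan k := by
    intro i hi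
    obtain _ | i := i
    · have h0 : (fun _ : ℝ => (0 : ℝ)) ∈ trigSpan k := (trigSpan k).zero_mem
      simpa using! h0
    · exact Submodule.subset_span (Finset.mem_coe.2 (Finset.mem_union_right _
        (Finset.mem_image_of_mem _ (Finset.mem_range.2 (by omega)))))
  obtain ⟨i, rfl | rfl⟩ := j.eq_nat_or_neg
  · simpa using hnat i (by simpa using hj)
  · have h := (trigSpan k).neg_mem (hnat i (by simpa using hj))
    convert h using 1
    ext θ
    simp

namespace LaurentPolynomial

/-- The Laurent polynomials with exponents between `-k` and `k`. -/
def bounded (k : ℕ) : Submodule ℂ ℂ[T;T⁻¹] :=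
  AddMonoidAlgebra.supported ℂ ℂ (Set.Icc (-(k : ℤ)) k)

theorem bounded_eq_span (k : ℕ) :
    bounded k = Submodule.span ℂ (T '' Set.Icc (-(k : ℤ)) k) :=
  AddMonoidAlgebra.supported_eq_span_single ..

theorem mem_bounded {k : ℕ} {q : ℂ[T;T⁻¹]} :
    q ∈ bounded k ↔ ∀ j : ℤ, (k : ℤ) < |j| → q.coeff j = 0 := by
  change (q.coeff.support : Set ℤ) ⊆ Set.Icc (-(k : ℤ)) k ↔ _
  constructor
  · intro h j hj
    by_contra hne
    exact absurd (abs_le.2 (h (Finsupp.mem_support_iff.2 hne))) (not_le.2 hj)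
  · intro h j hj
    exact abs_le.1 (not_lt.1 fun hlt => Finsupp.mem_support_iff.1 hj (h j hlt))

theorem bounded_mono {k l : ℕ} (h : k ≤ l) : bounded k ≤ bounded l :=
  fun _ hq => mem_bounded.2 fun j hj => mem_bounded.1 hq j (by omega)

theorem mul_mem_bounded {k l : ℕ} {p q : ℂ[T;T⁻¹]} (hp : p ∈ bounded k) (hq : q ∈ bounded l) :
    p * q ∈ bounded (k + l) := by
  have h : bounded k * bounded l ≤ bounded (k + l) := by
    rw [bounded_eq_span, bounded_eq_span, bounded_eq_span, Submodule.span_mul_span,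
      Submodule.span_le]
    rintro _ ⟨_, ⟨i, hi, rfl⟩, _, ⟨j, hj, rfl⟩, rfl⟩
    rw [Set.mem_Icc] at hi hj
    exact Submodule.subset_span ⟨i + j, ⟨by push_cast; omega, by push_cast; omega⟩, T_add i j⟩
  exact h (Submodule.mul_mem_mul hp hq)

theorem one_mem_bounded (k : ℕ) : (1 : ℂ[T;T⁻¹]) ∈ bounded k := by
  rw [bounded_eq_span]
  exact Submodule.subset_span ⟨0, by simp, T_zero⟩

theorem pow_mem_bounded {k : ℕ} {q : ℂ[T;T⁻¹]} (hq : q ∈ bounded k) (n : ℕ) :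
    q ^ n ∈ bounded (n * k) := by
  induction n with
  | zero => simpa using one_mem_bounded 0
  | succ n ih => rw [pow_succ, add_mul, one_mul]; exact mul_mem_bounded ih hq

theorem aeval_mem_bounded {k d : ℕ} {p q : ℂ[T;T⁻¹]} (hp : p ∈ bounded k) (hq : q ∈ bounded k)
    {f : MvPolynomial (Fin 2) ℂ} (hf : f.totalDegree ≤ d) : aeval ![p, q] f ∈ bounded (d * k) := by
  rw [aeval_def, eval₂_eq']
  refine Submodule.sum_mem _ fun n hn => ?_
  rw [← Algebra.smul_def, Fin.prod_univ_two]
  refine Submodule.smul_mem _ _ ?_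
  have hn' : n 0 + n 1 ≤ d := by
    have := (le_totalDegree hn).trans hf
    rwa [Finsupp.sum_fintype _ _ (fun _ => rfl), Fin.sum_univ_two] at this
  refine bounded_mono (Nat.mul_le_mul_right k hn') ?_
  rw [add_mul]
  exact mul_mem_bounded (pow_mem_bounded hp _) (pow_mem_bounded hq _)

/-- Passing to real parts gives the real dimension `2 k + 1`; the complex space `bounded k` has
twice that over `ℝ`, too much for a sharp degree bound. -/
theorem re_evalCircle_mem_trigSpan {k : ℕ} {q : ℂ[T;T⁻¹]} (hq : q ∈ bounded k) :
    (fun θ : ℝ => (evalCircle θ q).re) ∈ trigSpan k := by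
  -- Real parts do not commute with complex scalars, so the span induction carries an arbitrary
  -- factor `c`.
  suffices h : ∀ c : ℂ, (fun θ : ℝ => (c * evalCircle θ q).re) ∈ trigSpan k by
    simpa using h 1
  rw [bounded_eq_span] at hq
  induction hq using Submodule.span_induction with
  | mem q hq =>
    obtain ⟨j, hj, rfl⟩ := hq
    intro c
    have hj' : |j| ≤ k := abs_le.2 hj
    have h := (trigSpan k).sub_mem ((trigSpan k).smul_mem c.re (cos_int_mem_trigSpan hj'))
      ((trigSpan k).smul_mem c.im (sin_int_mem_trigSpan hj'))
    convert h using 1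
    ext θ
    have : (j : ℂ) * ((θ : ℂ) * Complex.I) = ((j * θ : ℝ) : ℂ) * Complex.I := by
      push_cast; ring
    rw [evalCircle_T, this, Complex.mul_re, Complex.exp_ofReal_mul_I_re,
      Complex.exp_ofReal_mul_I_im]
    simp
  | zero =>
    intro c
    have h0 : (fun _ : ℝ => (0 : ℝ)) ∈ trigSpan k := (trigSpan k).zero_mem
    simpa using! h0
  | add p q _ _ hp hq =>
    intro c
    convert (trigSpan k).add_mem (hp c) (hq c) using 1
    ext θ
    simp [mul_add]
  | smul a q _ hq =>
    intro c
    convert hq (c * a) using 1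
    ext θ
    rw [smul_eq_C_mul, map_mul, evalCircle_C, mul_assoc]

end LaurentPolynomial

/-! ### Partial derivatives and the chain rule -/

theorem MvPolynomial.totalDegree_pderiv_lt {σ R : Type*} [CommSemiring R] {f : MvPolynomial σ R}
    {i : σ} (h : pderiv i f ≠ 0) : (pderiv i f).totalDegree < f.totalDegree := by
  have key : ∀ m ∈ (pderiv i f).support, (m.sum fun _ e => e) < f.totalDegree := by
    intro m hm
    rw [mem_support_iff, coeff_pderiv] at hm
    have h1 := le_totalDegree (mem_support_iff.2 (left_ne_zero_of_mul hm))
    rw [Finsupp.sum_add_index' (fun _ => rfl) (fun _ _ _ => rfl), Finsupp.sum_single_index rfl]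
      at h1
    omega
  obtain ⟨m, hm⟩ := support_nonempty.2 h
  exact (Finset.sup_lt_iff ((Nat.zero_le _).trans_lt (key m hm))).2 key

/-- A nonzero partial derivative has smaller degree than `f`, so divisibility forces all of them to
vanish, which in characteristic zero makes `f` constant. This is what makes the gradient nonzero on
the curve. -/
theorem MvPolynomial.exists_not_dvd_pderiv {σ k : Type*} [Field k] [CharZero k]
    {f : MvPolynomial σ k} (hf : Irreducible f) : ∃ i, ¬ f ∣ pderiv i f := by
  by_contra! hdvd
  have hzero : ∀ i, pderiv i f = 0 := by
    intro i
    by_contra h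
    obtain ⟨q, hq⟩ := hdvd i
    have hq0 : q ≠ 0 := by
      rintro rfl
      exact h (by rw [hq, mul_zero])
    have h1 := totalDegree_pderiv_lt h
    rw [hq, totalDegree_mul_of_isDomain hf.ne_zero hq0] at h1
    omega
  have hC : f = C (coeff 0 f) := by
    classical
    ext m
    rw [coeff_C]
    split_ifs with h0
    · rw [← h0]
    · obtain ⟨i, hi⟩ : ∃ i, m i ≠ 0 := by
        by_contra! hm
        exact h0 (Finsupp.ext fun i => (hm i).symm)
      have h1 := coeff_pderiv (i := i) f (m - Finsupp.single i 1)
      rw [hzero i, coeff_zero, tsub_add_cancel_of_le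
        (Finsupp.single_le_iff.2 (Nat.one_le_iff_ne_zero.2 hi))] at h1
      exact (mul_eq_zero.1 h1.symm).resolve_right (Nat.cast_add_one_ne_zero _)
  have h0 : coeff 0 f ≠ 0 := by
    intro h
    rw [h, map_zero] at hC
    exact hf.ne_zero hC
  exact hf.not_isUnit (hC ▸ (isUnit_iff_ne_zero.2 h0).map C)

theorem MvPolynomial.degreeOf_map_of_injective {σ R S : Type*} [CommSemiring R] [CommSemiring S]
    {φ : R →+* S} (hφ : Function.Injective φ) (i : σ) (f : MvPolynomial σ R) :
    degreeOf i (map φ f) = degreeOf i f := by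
  classical
  rw [degreeOf_eq_sup, degreeOf_eq_sup, support_map_of_injective _ hφ]

theorem MvPolynomial.hasDerivAt_aeval {f : MvPolynomial (Fin 2) ℝ} {γ : ℝ → Fin 2 → ℝ}
    {x' y' θ : ℝ} (hx : HasDerivAt (fun t => γ t 0) x' θ) (hy : HasDerivAt (fun t => γ t 1) y' θ) :
    HasDerivAt (fun t => aeval (γ t) f)
      (aeval (γ θ) (pderiv 0 f) * x' + aeval (γ θ) (pderiv 1 f) * y') θ := by
  induction f using MvPolynomial.induction_on with
  | C a => simpa using hasDerivAt_const θ a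
  | add p q hp hq =>
    simp only [map_add]
    exact (hp.add hq).congr_deriv (by ring)
  | mul_X p i hp =>
    simp only [map_mul, aeval_X, pderiv_mul, map_add, pderiv_X]
    fin_cases i
    · exact (hp.mul hx).congr_deriv (by simp; ring)
    · exact (hp.mul hy).congr_deriv (by simp; ring)

/-! ### Translation between trigonometric functions and Laurent polynomials -/

namespace LaurentPolynomial

theorem hasDerivAt_of_evalCircle {p : ℝ → ℝ} {P Q : ℂ[T;T⁻¹]}
    (hp : ∀ θ, (p θ : ℂ) = evalCircle θ P)
    (hQ : ∀ θ : ℝ, HasDerivAt (fun t : ℝ => evalCircle t P) (evalCircle θ Q) θ) (θ : ℝ) :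
    HasDerivAt p (deriv p θ) θ ∧ ((deriv p θ : ℝ) : ℂ) = evalCircle θ Q := by
  have h : HasDerivAt (fun t : ℝ => (p t : ℂ)) (evalCircle θ Q) θ := by
    simpa only [hp] using hQ θ
  have hre : HasDerivAt p (evalCircle θ Q).re θ :=
    Complex.reCLM.hasFDerivAt.comp_hasDerivAt θ h
  -- The imaginary part of the real function `p` is constantly zero, so `Q` is real on the circle.
  have him : HasDerivAt (fun _ : ℝ => (0 : ℝ)) (evalCircle θ Q).im θ :=
    Complex.imCLM.hasFDerivAt.comp_hasDerivAt θ h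
  have him0 : (evalCircle θ Q).im = 0 := him.unique (hasDerivAt_const θ 0)
  refine ⟨hre.differentiableAt.hasDerivAt, ?_⟩
  rw [hre.deriv]
  exact Complex.ext rfl him0.symm

/-- The Laurent polynomial of the cosine. -/
def cosL : ℂ[T;T⁻¹] := C (1 / 2) * (T 1 + T (-1))

/-- The Laurent polynomial of the sine. -/
def sinL : ℂ[T;T⁻¹] := C (1 / (2 * Complex.I)) * (T 1 - T (-1))

theorem evalCircle_cosL (θ : ℝ) : evalCircle θ cosL = (Real.cos θ : ℂ) := by
  rw [cosL, map_mul, map_add, evalCircle_C, evalCircle_T, evalCircle_T, Complex.ofReal_cos,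
    Complex.cos]
  push_cast
  ring_nf

theorem evalCircle_sinL (θ : ℝ) : evalCircle θ sinL = (Real.sin θ : ℂ) := by
  rw [sinL, map_mul, map_sub, evalCircle_C, evalCircle_T, evalCircle_T, Complex.ofReal_sin,
    Complex.sin]
  field_simp
  rw [Complex.I_sq]
  push_cast
  ring_nf

theorem coeff_mul_cosL (q : ℂ[T;T⁻¹]) (j : ℤ) :
    (q * cosL).coeff j = (q.coeff (j - 1) + q.coeff (j + 1)) / 2 := by
  rw [cosL, mul_left_comm, coeff_C_mul, mul_add, AddMonoidAlgebra.coeff_add, Finsupp.add_apply,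
    coeff_mul_T, coeff_mul_T, sub_neg_eq_add]
  ring

theorem coeff_mul_sinL (q : ℂ[T;T⁻¹]) (j : ℤ) :
    (q * sinL).coeff j = (q.coeff (j - 1) - q.coeff (j + 1)) / (2 * Complex.I) := by
  rw [sinL, mul_left_comm, coeff_C_mul, mul_sub, AddMonoidAlgebra.coeff_sub, Finsupp.sub_apply,
    coeff_mul_T, coeff_mul_T, sub_neg_eq_add]
  ring

/-- Evaluation of real bivariate polynomials at a pair of Laurent polynomials. -/
def evalPair (p q : ℂ[T;T⁻¹]) : MvPolynomial (Fin 2) ℝ →+* ℂ[T;T⁻¹] :=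
  (aeval ![p, q] : MvPolynomial (Fin 2) ℂ →ₐ[ℂ] ℂ[T;T⁻¹]).toRingHom.comp
    (map (algebraMap ℝ ℂ))

theorem evalCircle_evalPair {p q : ℂ[T;T⁻¹]} {θ : ℝ} {v : Fin 2 → ℝ}
    (h0 : (v 0 : ℂ) = evalCircle θ p) (h1 : (v 1 : ℂ) = evalCircle θ q)
    (f : MvPolynomial (Fin 2) ℝ) : evalCircle θ (evalPair p q f) = ((aeval v f : ℝ) : ℂ) := by
  have h : (evalCircle θ).comp (evalPair p q) = Complex.ofRealHom.comp (aeval v).toRingHom := by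
    apply MvPolynomial.ringHom_ext
    · intro r
      simp [evalPair, ← LaurentPolynomial.C_eq_algebraMap, evalCircle_C]
    · intro i
      fin_cases i
      · simp [evalPair, h0]
      · simp [evalPair, h1]
  exact DFunLike.congr_fun h f

theorem toRatFunc_aeval (p q : ℂ[T;T⁻¹]) (f : MvPolynomial (Fin 2) ℂ) :
    toRatFunc (aeval ![p, q] f) = aeval ![toRatFunc p, toRatFunc q] f := by
  have h : toRatFunc.comp (aeval ![p, q] : MvPolynomial (Fin 2) ℂ →ₐ[ℂ] ℂ[T;T⁻¹]).toRingHom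
      = (aeval ![toRatFunc p, toRatFunc q] : MvPolynomial (Fin 2) ℂ →ₐ[ℂ] RatFunc ℂ).toRingHom := by
    apply MvPolynomial.ringHom_ext
    · intro r
      simp [← LaurentPolynomial.C_eq_algebraMap, toRatFunc_C]
    · intro i
      fin_cases i <;> simp
  exact DFunLike.congr_fun h f

theorem transcendental_toRatFunc {q : ℂ[T;T⁻¹]} {j : ℤ} (hj : j ≠ 0) (hq : q.coeff j ≠ 0) :
    Transcendental ℂ (toRatFunc q) := by
  refine RatFunc.transcendental_of_ne_C _ ?_
  rintro ⟨c, hc⟩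
  have h : q = C c := toRatFunc_injective (by rw [hc, toRatFunc_C, RatFunc.algebraMap_eq_C])
  rw [h, C_apply, if_neg hj] at hq
  exact hq rfl

end LaurentPolynomial

/-! ### Coordinates of the curve and birationality -/

namespace LaurentPolynomial

/-- The first coordinate `p cos θ - p' sin θ` as a Laurent polynomial. -/
def curveX (P Q : ℂ[T;T⁻¹]) : ℂ[T;T⁻¹] := P * cosL - Q * sinL

/-- The second coordinate `p sin θ + p' cos θ` as a Laurent polynomial. -/
def curveY (P Q : ℂ[T;T⁻¹]) : ℂ[T;T⁻¹] := P * sinL + Q * cosL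

section Coefficients

variable {P Q : ℂ[T;T⁻¹]} (hQ : ∀ j : ℤ, Q.coeff j = j * Complex.I * P.coeff j)
include hQ

theorem coeff_curveX (j : ℤ) :
    (curveX P Q).coeff j = (P.coeff (j - 1) * (2 - j) + P.coeff (j + 1) * (2 + j)) / 2 := by
  rw [curveX, AddMonoidAlgebra.coeff_sub, Finsupp.sub_apply, coeff_mul_cosL, coeff_mul_sinL, hQ, hQ]
  field_simp
  push_cast
  ring

theorem coeff_curveY (j : ℤ) :
    (curveY P Q).coeff j
      = (P.coeff (j - 1) * (2 - j) - P.coeff (j + 1) * (2 + j)) / (2 * Complex.I) := by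
  rw [curveY, AddMonoidAlgebra.coeff_add, Finsupp.add_apply, coeff_mul_cosL, coeff_mul_sinL, hQ, hQ]
  field_simp
  rw [Complex.I_sq]
  push_cast
  ring

/-- On the circle `X + i Y = z (p + i p')`, and `p'` has mean zero. -/
theorem coeff_curveX_add_I_mul_curveY :
    (curveX P Q + C Complex.I * curveY P Q).coeff 1 = P.coeff 0 := by
  rw [AddMonoidAlgebra.coeff_add, Finsupp.add_apply, coeff_C_mul, coeff_curveX hQ, coeff_curveY hQ]
  field_simp
  norm_num
  ring

variable {N : ℕ} (hP : P ∈ bounded N)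
include hP

theorem curveX_mem_bounded : curveX P Q ∈ bounded (N + 1) := by
  rw [mem_bounded] at hP ⊢
  intro j hj
  rw [coeff_curveX hQ, hP, hP]
  · simp
  all_goals
    push_cast at hj
    rw [lt_abs] at hj ⊢
    omega

theorem curveY_mem_bounded : curveY P Q ∈ bounded (N + 1) := by
  rw [mem_bounded] at hP ⊢
  intro j hj
  rw [coeff_curveY hQ, hP, hP]
  · simp
  all_goals
    push_cast at hj
    rw [lt_abs] at hj ⊢
    omega

omit hQ hP in
theorem one_sub_ne_zero_of_two_le (hN : 2 ≤ N) : (1 - N : ℂ) ≠ 0 := by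
  rw [sub_ne_zero]
  exact_mod_cast (by omega : (1 : ℕ) ≠ N)

/-- Both extreme coefficients are nonzero multiples of `(1 - N) * P.coeff N`; the factor `1 - N` is
the reason for `2 ≤ N`. -/
theorem coeff_curve_top (hN : 2 ≤ N) (htop : P.coeff N ≠ 0) :
    (curveX P Q).coeff ((N + 1 : ℕ) : ℤ) ≠ 0 ∧ (curveY P Q).coeff ((N + 1 : ℕ) : ℤ) ≠ 0 := by
  have h0 : P.coeff (((N + 1 : ℕ) : ℤ) + 1) = 0 :=
    mem_bounded.1 hP _ (by rw [lt_abs]; push_cast; omega)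
  have h1 : ((N + 1 : ℕ) : ℤ) - 1 = N := by push_cast; ring
  have h2 : (2 : ℂ) - (((N + 1 : ℕ) : ℤ) : ℂ) = 1 - N := by push_cast; ring
  have h3 := one_sub_ne_zero_of_two_le hN
  rw [coeff_curveX hQ, coeff_curveY hQ, h0, h1, h2, zero_mul, add_zero, sub_zero]
  exact ⟨div_ne_zero (mul_ne_zero htop h3) two_ne_zero,
    div_ne_zero (mul_ne_zero htop h3) (mul_ne_zero two_ne_zero Complex.I_ne_zero)⟩

theorem coeff_curve_bot (hN : 2 ≤ N) (hbot : P.coeff (-N) ≠ 0) :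
    (curveX P Q).coeff (-((N + 1 : ℕ) : ℤ)) ≠ 0 ∧
      (curveY P Q).coeff (-((N + 1 : ℕ) : ℤ)) ≠ 0 := by
  have h0 : P.coeff (-((N + 1 : ℕ) : ℤ) - 1) = 0 :=
    mem_bounded.1 hP _ (by rw [lt_abs]; push_cast; omega)
  have h1 : -((N + 1 : ℕ) : ℤ) + 1 = -N := by push_cast; ring
  have h2 : (2 : ℂ) + ((-((N + 1 : ℕ) : ℤ) : ℤ) : ℂ) = 1 - N := by push_cast; ring
  have h3 := one_sub_ne_zero_of_two_le hN
  rw [coeff_curveX hQ, coeff_curveY hQ, h0, h1, h2, zero_mul, zero_add, zero_sub]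
  exact ⟨div_ne_zero (mul_ne_zero hbot h3) two_ne_zero,
    div_ne_zero (neg_ne_zero.2 (mul_ne_zero hbot h3)) (mul_ne_zero two_ne_zero Complex.I_ne_zero)⟩

end Coefficients

theorem toRatFunc_evalPair_mem (p q : ℂ[T;T⁻¹]) (f : MvPolynomial (Fin 2) ℝ) :
    toRatFunc (evalPair p q f) ∈ IntermediateField.adjoin ℂ {toRatFunc p, toRatFunc q} := by
  change toRatFunc (aeval ![p, q] (map (algebraMap ℝ ℂ) f)) ∈ _
  rw [toRatFunc_aeval]
  induction map (algebraMap ℝ ℂ) f using MvPolynomial.induction_on with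
  | C a => rw [aeval_C]; exact IntermediateField.algebraMap_mem _ a
  | add g h hg hh => rw [map_add]; exact add_mem hg hh
  | mul_X g i hg =>
    rw [map_mul, aeval_X]
    refine mul_mem hg (IntermediateField.subset_adjoin _ _ ?_)
    fin_cases i <;> simp

/-- The normal direction `(cos θ, sin θ)` being a rational function of the point of the curve,
the parametrization is birational. -/
theorem adjoin_curve_eq_top {X Y : ℂ[T;T⁻¹]} {a b : MvPolynomial (Fin 2) ℝ}
    (hab : evalPair X Y a * sinL = evalPair X Y b * cosL)
    (hne : evalPair X Y a ≠ 0 ∨ evalPair X Y b ≠ 0) (hodd : (X + C Complex.I * Y).coeff 1 ≠ 0) :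
    IntermediateField.adjoin ℂ {toRatFunc X, toRatFunc Y} = ⊤ := by
  set S := IntermediateField.adjoin ℂ {toRatFunc X, toRatFunc Y} with hS
  set A := toRatFunc (evalPair X Y a) with hA
  set B := toRatFunc (evalPair X Y b) with hB
  set ι : RatFunc ℂ := algebraMap ℂ (RatFunc ℂ) Complex.I with hι
  set z : RatFunc ℂ := RatFunc.X with hz
  have hAS : A ∈ S := toRatFunc_evalPair_mem X Y a
  have hBS : B ∈ S := toRatFunc_evalPair_mem X Y b
  have hιS : ι ∈ S := S.algebraMap_mem _
  have hz0 : z ≠ 0 := RatFunc.X_ne_zero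
  have hι2 : ι * ι = -1 := by rw [hι, ← map_mul, Complex.I_mul_I, map_neg, map_one]
  have hI : algebraMap ℂ (RatFunc ℂ) (1 / (2 * Complex.I)) = -ι / 2 := by
    rw [hι, show (1 : ℂ) / (2 * Complex.I) = -Complex.I / 2 by field_simp; simp,
      map_div₀, map_neg, map_ofNat]
  -- This is `A sin θ = B cos θ` written in `z` and cleared of denominators.
  have hrel : (A - ι * B) * z ^ 2 = A + ι * B := by
    have h := congrArg toRatFunc hab
    rw [map_mul, map_mul, sinL, cosL, map_mul, map_mul, map_sub, map_add, toRatFunc_C, toRatFunc_C,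
      toRatFunc_T, toRatFunc_T, hI, ← hA, ← hB] at h
    simp only [zpow_one, zpow_neg, map_div₀, map_one, map_ofNat] at h
    rw [← hz] at h
    field_simp at h
    linear_combination ι * h + (A * (z ^ 2 - 1)) * hι2
  -- If `A - i B` vanished, so would `A + i B`, and hence both `A` and `B`.
  have hden : A - ι * B ≠ 0 := by
    intro h
    rw [h, zero_mul] at hrel
    have hA0 : A = 0 := by linear_combination (1 / 2) * h - (1 / 2) * hrel
    have hB0 : B = 0 := by
      rw [hA0, zero_add] at hrel
      exact (mul_eq_zero.1 hrel.symm).resolve_left fun h0 => by simp [h0] at hι2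
    rcases hne with h1 | h1
    · exact h1 (toRatFunc_injective (by rw [← hA, hA0, map_zero]))
    · exact h1 (toRatFunc_injective (by rw [← hB, hB0, map_zero]))
  have hz2 : z ^ 2 ∈ S := by
    rw [eq_div_of_mul_eq hden ((mul_comm _ _).trans hrel)]
    exact div_mem (add_mem hAS (mul_mem hιS hBS)) (sub_mem hAS (mul_mem hιS hBS))
  -- With `X + i Y = e + z o` and `e`, `o` in `S`, solving for `z` only needs `o ≠ 0`; its constant
  -- term is the coefficient assumed nonzero in `hodd`.
  obtain ⟨e, o, he, ho, heo, hcoeff⟩ := exists_even_odd hz2 (X + C Complex.I * Y)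
  have ho0 : toRatFunc o ≠ 0 := by
    intro h
    rw [toRatFunc_injective (h.trans (map_zero _).symm)] at hcoeff
    exact hodd (by rw [← hcoeff]; rfl)
  have hXYS : toRatFunc (X + C Complex.I * Y) ∈ S := by
    rw [map_add, map_mul, toRatFunc_C]
    exact add_mem (IntermediateField.subset_adjoin _ _ (by simp))
      (mul_mem hιS (IntermediateField.subset_adjoin _ _ (by simp)))
  have hzS : z ∈ S := by
    have h := congrArg toRatFunc heo
    rw [map_add toRatFunc e, map_mul, toRatFunc_T, zpow_one] at h
    have h2 : z = (toRatFunc (X + C Complex.I * Y) - toRatFunc e) / toRatFunc o := by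
      rw [h, eq_div_iff ho0]; ring
    rw [h2]
    exact div_mem (sub_mem hXYS he) ho
  rw [eq_top_iff, ← RatFunc.adjoin_X]
  exact IntermediateField.adjoin_simple_le_iff.2 hzS

end LaurentPolynomial

/-! ### The ideal of the curve and its degree bounds -/

namespace LaurentPolynomial

theorem vanishingIdeal_eq_ker {p : ℝ → ℝ} {X Y : ℂ[T;T⁻¹]}
    (hX : ∀ θ, (supportParam p θ 0 : ℂ) = evalCircle θ X)
    (hY : ∀ θ, (supportParam p θ 1 : ℂ) = evalCircle θ Y) :
    vanishingIdeal ℝ (supportCurve p) = RingHom.ker (evalPair X Y) := by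
  ext f
  rw [mem_vanishingIdeal_iff, RingHom.mem_ker]
  constructor
  · intro h
    refine eq_zero_of_evalCircle fun θ hθ => ?_
    rw [evalCircle_evalPair (hX θ) (hY θ), h _ ⟨θ, hθ, rfl⟩, Complex.ofReal_zero]
  · rintro h _ ⟨θ, -, rfl⟩
    have h1 := evalCircle_evalPair (hX θ) (hY θ) f
    rw [h, map_zero] at h1
    exact_mod_cast h1.symm

/-- A nonzero polynomial that vanishes on a birationally parametrized curve has at least the
degree of the coordinate functions. -/
theorem two_mul_le_degreeOf {X Y : ℂ[T;T⁻¹]} {M : ℕ} (hM : M ≠ 0)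
    (hX : X ∈ bounded M) (hXtop : X.coeff M ≠ 0) (hXbot : X.coeff (-M) ≠ 0)
    (hY : Y ∈ bounded M) (hYtop : Y.coeff M ≠ 0) (hYbot : Y.coeff (-M) ≠ 0)
    (htop : IntermediateField.adjoin ℂ {toRatFunc X, toRatFunc Y} = ⊤)
    {h : MvPolynomial (Fin 2) ℝ} (h0 : h ≠ 0) (hh : evalPair X Y h = 0) :
    2 * M ≤ degreeOf 0 h ∧ 2 * M ≤ degreeOf 1 h := by
  have hM' : (M : ℤ) ≠ 0 := by exact_mod_cast hM
  have hinj : Function.Injective (algebraMap ℝ ℂ) := (algebraMap ℝ ℂ).injective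
  set g := map (algebraMap ℝ ℂ) h with hg
  have hg0 : g ≠ 0 := by
    rw [hg, Ne, map_eq_zero_iff _ (map_injective _ hinj)]
    exact h0
  have hgz : aeval ![toRatFunc X, toRatFunc Y] g = 0 := by
    rw [← toRatFunc_aeval]
    exact (congrArg toRatFunc hh).trans (map_zero _)
  constructor
  · rw [← degreeOf_map_of_injective hinj, ← finrank_adjoin_toRatFunc (mem_bounded.1 hY) hYtop hYbot]
    exact finrank_le_degreeOf_zero (transcendental_toRatFunc hM' hYtop) htop hg0 hgz
  -- Exchanging the variables reduces the second bound to the lemma for the first variable.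
  · let σ : Fin 2 ≃ Fin 2 := Equiv.swap 0 1
    have hσ : degreeOf 0 (rename σ g) = degreeOf 1 h := by
      rw [← degreeOf_map_of_injective hinj, ← degreeOf_rename_of_injective σ.injective 1]
      simp [σ, hg]
    rw [← hσ, ← finrank_adjoin_toRatFunc (mem_bounded.1 hX) hXtop hXbot]
    refine finrank_le_degreeOf_zero (transcendental_toRatFunc hM' hXtop)
      (s := toRatFunc Y) (by rw [Set.pair_comm]; exact htop) ?_ ?_
    · rwa [Ne, map_eq_zero_iff _ (rename_injective _ σ.injective)]
    · rw [aeval_rename, ← hgz]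
      congr 2
      ext i
      fin_cases i <;> simp [σ]

theorem eq_zero_of_evalPair_rename {X Y : ℂ[T;T⁻¹]} (hY : Transcendental ℂ (toRatFunc Y))
    (c : MvPolynomial (Fin 1) ℝ) (hc : evalPair X Y (rename Fin.succ c) = 0) : c = 0 := by
  have h1 : AlgebraicIndependent ℂ (fun _ : Fin 1 => toRatFunc Y) :=
    algebraicIndependent_unique_type_iff.2 hY
  have h2 : aeval (fun _ : Fin 1 => toRatFunc Y) (map (algebraMap ℝ ℂ) c) = 0 := by
    have h3 : toRatFunc (aeval ![X, Y] (map (algebraMap ℝ ℂ) (rename Fin.succ c))) = 0 :=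
      (congrArg toRatFunc hc).trans (map_zero _)
    rw [toRatFunc_aeval, map_rename, aeval_rename] at h3
    rw [← h3]
    congr 2
    ext i
    fin_cases i
    simp
  have h4 : map (algebraMap ℝ ℂ) c = 0 := h1 (h2.trans (map_zero _).symm)
  exact (map_eq_zero_iff _ (map_injective _ (algebraMap ℝ ℂ).injective)).1 h4

/-- Restriction of polynomials to a curve parametrized by the angle. -/
def restrictParam (γ : ℝ → Fin 2 → ℝ) : MvPolynomial (Fin 2) ℝ →ₗ[ℝ] ℝ → ℝ :=
  LinearMap.pi fun θ => (aeval (γ θ) : MvPolynomial (Fin 2) ℝ →ₐ[ℝ] ℝ).toLinearMap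

theorem restrictParam_mem_trigSpan {γ : ℝ → Fin 2 → ℝ} {X Y : ℂ[T;T⁻¹]} {M : ℕ}
    (hγX : ∀ θ, (γ θ 0 : ℂ) = evalCircle θ X) (hγY : ∀ θ, (γ θ 1 : ℂ) = evalCircle θ Y)
    (hX : X ∈ bounded M) (hY : Y ∈ bounded M) (d : ℕ) (g : MvPolynomial (Fin 2) ℝ)
    (hg : g.totalDegree ≤ d) : restrictParam γ g ∈ trigSpan (d * M) := by
  have hmem : evalPair X Y g ∈ bounded (d * M) :=
    aeval_mem_bounded hX hY ((Finset.sup_mono (support_map_subset _ g)).trans hg)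
  convert re_evalCircle_mem_trigSpan hmem using 1
  ext θ
  rw [evalCircle_evalPair (hγX θ) (hγY θ), Complex.ofReal_re]
  rfl

/-- The chain rule along a curve with normal direction `(cos θ, sin θ)`. -/
theorem evalPair_pderiv_mul_sinL {γ : ℝ → Fin 2 → ℝ} {X Y W : ℂ[T;T⁻¹]} {w : ℝ → ℝ}
    (hγX : ∀ θ, (γ θ 0 : ℂ) = evalCircle θ X) (hγY : ∀ θ, (γ θ 1 : ℂ) = evalCircle θ Y)
    (hw : ∀ θ, (w θ : ℂ) = evalCircle θ W) (hW : W ≠ 0)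
    (hx : ∀ θ, HasDerivAt (fun t => γ t 0) (-(w θ * Real.sin θ)) θ)
    (hy : ∀ θ, HasDerivAt (fun t => γ t 1) (w θ * Real.cos θ) θ)
    {f : MvPolynomial (Fin 2) ℝ} (hf : evalPair X Y f = 0) :
    evalPair X Y (pderiv 0 f) * sinL = evalPair X Y (pderiv 1 f) * cosL := by
  have hzero : ∀ t, aeval (γ t) f = 0 := by
    intro t
    have h := evalCircle_evalPair (hγX t) (hγY t) f
    rw [hf, map_zero] at h
    exact_mod_cast h.symm
  have key : W * (evalPair X Y (pderiv 1 f) * cosL - evalPair X Y (pderiv 0 f) * sinL) = 0 := by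
    refine eq_zero_of_evalCircle fun θ _ => ?_
    have h := hasDerivAt_aeval (f := f) (hx θ) (hy θ)
    simp only [hzero] at h
    have h1 := h.unique (hasDerivAt_const θ 0)
    rw [map_mul, map_sub, map_mul, map_mul, evalCircle_cosL, evalCircle_sinL,
      evalCircle_evalPair (hγX θ) (hγY θ), evalCircle_evalPair (hγX θ) (hγY θ), ← hw]
    have h2 : w θ * (aeval (γ θ) (pderiv 1 f) * Real.cos θ
        - aeval (γ θ) (pderiv 0 f) * Real.sin θ) = 0 := by
      linear_combination h1
    exact_mod_cast h2
  -- The speed `w` may vanish at some angles, but as a nonzero element of a domain it cancels.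
  exact (sub_eq_zero.1 ((mul_eq_zero.1 key).resolve_left hW)).symm

end LaurentPolynomial

/-! ### Degree of the curve of a general trigonometric support function -/

open LaurentPolynomial in
/-- The curve with support function a trigonometric polynomial of degree `N ≥ 2` with nonzero mean
is an irreducible algebraic curve of degree `2 N + 2`. -/
theorem isDefiningPolynomial_supportCurve {p : ℝ → ℝ} {P : ℂ[T;T⁻¹]} {N : ℕ} (hN : 2 ≤ N)
    (hp : ∀ θ, (p θ : ℂ) = evalCircle θ P) (hP : P ∈ bounded N) (htop : P.coeff N ≠ 0)
    (hbot : P.coeff (-N) ≠ 0) (hmean : P.coeff 0 ≠ 0) :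
    (∃ f, IsDefiningPolynomial (supportCurve p) f) ∧
      ∀ f, IsDefiningPolynomial (supportCurve p) f →
        f.totalDegree = 2 * (N + 1) ∧ f.degreeOf 0 = 2 * (N + 1) ∧
          f.degreeOf 1 = 2 * (N + 1) := by
  obtain ⟨Q, hQ, hQ'⟩ := exists_hasDerivAt_evalCircle P
  obtain ⟨R, hR, hR'⟩ := exists_hasDerivAt_evalCircle Q
  have hp1 := hasDerivAt_of_evalCircle hp hQ'
  have hp2 := hasDerivAt_of_evalCircle (fun θ => (hp1 θ).2) hR'
  set X := curveX P Q with hXdef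
  set Y := curveY P Q with hYdef
  have hγX : ∀ θ, (supportParam p θ 0 : ℂ) = evalCircle θ X := by
    intro θ
    rw [hXdef, curveX, map_sub, map_mul, map_mul, evalCircle_cosL, evalCircle_sinL, ← hp,
      ← (hp1 θ).2]
    simp [supportParam]
  have hγY : ∀ θ, (supportParam p θ 1 : ℂ) = evalCircle θ Y := by
    intro θ
    rw [hYdef, curveY, map_add, map_mul, map_mul, evalCircle_cosL, evalCircle_sinL, ← hp,
      ← (hp1 θ).2]
    simp [supportParam]
  have hx : ∀ θ, HasDerivAt (fun t => supportParam p t 0)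
      (-((p θ + deriv (deriv p) θ) * Real.sin θ)) θ := by
    intro θ
    have h := ((hp1 θ).1.mul (Real.hasDerivAt_cos θ)).sub ((hp2 θ).1.mul (Real.hasDerivAt_sin θ))
    exact h.congr_deriv (by ring)
  have hy : ∀ θ, HasDerivAt (fun t => supportParam p t 1)
      ((p θ + deriv (deriv p) θ) * Real.cos θ) θ := by
    intro θ
    have h := ((hp1 θ).1.mul (Real.hasDerivAt_sin θ)).add ((hp2 θ).1.mul (Real.hasDerivAt_cos θ))
    exact h.congr_deriv (by ring)
  -- The second derivative has no constant term, so `p + p''` has the same nonzero mean as `p`.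
  have hW : P + R ≠ 0 := by
    intro h
    have h1 : (P + R).coeff 0 = P.coeff 0 := by
      rw [AddMonoidAlgebra.coeff_add, Finsupp.add_apply, hR]
      simp
    rw [h] at h1
    exact hmean h1.symm
  have hw : ∀ θ, ((p θ + deriv (deriv p) θ : ℝ) : ℂ) = evalCircle θ (P + R) := by
    intro θ
    rw [map_add, ← hp, ← (hp2 θ).2, Complex.ofReal_add]
  have hXb : X ∈ bounded (N + 1) := curveX_mem_bounded hQ hP
  have hYb : Y ∈ bounded (N + 1) := curveY_mem_bounded hQ hP
  obtain ⟨hXt, hYt⟩ := coeff_curve_top hQ hP hN htop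
  obtain ⟨hXn, hYn⟩ := coeff_curve_bot hQ hP hN hbot
  have hker := vanishingIdeal_eq_ker hγX hγY
  have hφ : ∀ g, restrictParam (supportParam p) g = 0 ↔ evalPair X Y g = 0 := by
    intro g
    constructor
    · intro h
      refine eq_zero_of_evalCircle fun θ _ => ?_
      rw [evalCircle_evalPair (hγX θ) (hγY θ)]
      exact_mod_cast congrFun h θ
    · intro h
      ext θ
      have h1 := evalCircle_evalPair (hγX θ) (hγY θ) g
      rw [h, map_zero] at h1
      exact_mod_cast h1.symm
  have hrank : ∀ d, Module.finrank ℝ (trigSpan (d * (N + 1))) ≤ d * (2 * (N + 1)) + 1 := by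
    intro d
    refine (finrank_trigSpan_le _).trans (le_of_eq (by ring))
  have hmem := restrictParam_mem_trigSpan hγX hγY hXb hYb
  constructor
  · obtain ⟨g, hg0, hg⟩ := exists_ne_zero_map_eq_zero (restrictParam (supportParam p))
      (2 * (N + 1)) (fun d => trigSpan (d * (N + 1))) hrank hmem
    have hprime : (RingHom.ker (evalPair X Y)).IsPrime := RingHom.ker_isPrime _
    -- A nonzero prime ideal of a factorial ring contains a prime element.
    obtain ⟨f, hf, hfp⟩ := hprime.exists_mem_prime_of_ne_bot
      (Submodule.ne_bot_iff _ |>.2 ⟨g, (hφ g).1 hg, hg0⟩)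
    refine ⟨f, hfp.irreducible, hker.trans ?_⟩
    exact eq_span_singleton_of_irreducible_mem (fun c hc => eq_zero_of_evalPair_rename
      (transcendental_toRatFunc (by positivity) hYt) c hc) hfp.irreducible hf
  · intro f hf
    have hdvd : ∀ g, evalPair X Y g = 0 ↔ f ∣ g := by
      intro g
      rw [← RingHom.mem_ker, ← hker, hf.vanishingIdeal_eq, Ideal.mem_span_singleton]
    have hf0 := hf.irreducible.ne_zero
    have hfz : evalPair X Y f = 0 := (hdvd f).2 dvd_rfl
    have hadj : IntermediateField.adjoin ℂ {toRatFunc X, toRatFunc Y} = ⊤ := by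
      refine adjoin_curve_eq_top (evalPair_pderiv_mul_sinL hγX hγY hw hW hx hy hfz) ?_ ?_
      · obtain ⟨i, hi⟩ := exists_not_dvd_pderiv hf.irreducible
        rw [← hdvd] at hi
        fin_cases i
        · exact Or.inl hi
        · exact Or.inr hi
      · rw [coeff_curveX_add_I_mul_curveY hQ]
        exact hmean
    have hlow := two_mul_le_degreeOf N.succ_ne_zero hXb hXt hXn hYb hYt hYn hadj hf0 hfz
    have hup : f.totalDegree ≤ 2 * (N + 1) := totalDegree_le_of_ker
      (restrictParam (supportParam p)) (2 * (N + 1)) (fun d => trigSpan (d * (N + 1))) hrank hmem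
      hf0 (fun g hg => (hdvd g).1 ((hφ g).1 hg))
    have h0 := degreeOf_le_totalDegree f 0
    have h1 := degreeOf_le_totalDegree f 1
    omega

/-! ### Fourier coefficients of the rotor's support function -/

namespace LaurentPolynomial

/-- The Laurent polynomial of the harmonic `a cos (j θ) + b sin (j θ)`. -/
def harmonic (a b : ℝ) (j : ℤ) : ℂ[T;T⁻¹] :=
  C ((a - b * Complex.I) / 2) * T j + C ((a + b * Complex.I) / 2) * T (-j)

theorem evalCircle_harmonic (a b : ℝ) (j : ℤ) (θ : ℝ) :
    evalCircle θ (harmonic a b j) = ((a * Real.cos (j * θ) + b * Real.sin (j * θ) : ℝ) : ℂ) := by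
  rw [harmonic, map_add, map_mul, map_mul, evalCircle_C, evalCircle_C, evalCircle_T, evalCircle_T]
  push_cast
  rw [Complex.cos, Complex.sin]
  ring_nf

theorem coeff_harmonic (a b : ℝ) (j i : ℤ) :
    (harmonic a b j).coeff i = (if j = i then ((a - b * Complex.I) / 2 : ℂ) else 0)
      + if -j = i then ((a + b * Complex.I) / 2 : ℂ) else 0 := by
  rw [harmonic, AddMonoidAlgebra.coeff_add, Finsupp.add_apply, coeff_C_mul_T, coeff_C_mul_T]

theorem coeff_harmonic_of_ne {a b : ℝ} {j i : ℤ} (h : j ≠ i) (h' : -j ≠ i) :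
    (harmonic a b j).coeff i = 0 := by
  rw [coeff_harmonic, if_neg h, if_neg h', add_zero]

theorem harmonic_coeff_ne_zero {a b : ℝ} (h : a ≠ 0 ∨ b ≠ 0) :
    ((a - b * Complex.I) / 2 : ℂ) ≠ 0 ∧ ((a + b * Complex.I) / 2 : ℂ) ≠ 0 := by
  constructor <;>
  · intro h0
    have hre := congrArg Complex.re h0
    have him := congrArg Complex.im h0
    simp at hre him
    tauto

/-- The Laurent polynomial of `rotorSupport`. -/
def rotor (n m : ℕ) (ρ : ℝ) (a b : ℤ → ℝ) : ℂ[T;T⁻¹] :=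
  C (ρ : ℂ) + ∑ k ∈ Finset.range (m + 1),
    (harmonic (a ((k : ℤ) * n + 1)) (b ((k : ℤ) * n + 1)) ((k : ℤ) * n + 1)
      + harmonic (a ((k : ℤ) * n - 1)) (b ((k : ℤ) * n - 1)) ((k : ℤ) * n - 1))

variable {n m : ℕ} {ρ : ℝ} {a b : ℤ → ℝ}

theorem evalCircle_rotor (θ : ℝ) :
    evalCircle θ (rotor n m ρ a b) = (rotorSupport n m ρ a b θ : ℂ) := by
  rw [rotor, map_add, evalCircle_C, map_sum, rotorSupport, Complex.ofReal_add, Complex.ofReal_sum]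
  congr 1
  refine Finset.sum_congr rfl fun k _ => ?_
  rw [map_add, evalCircle_harmonic, evalCircle_harmonic, ← Complex.ofReal_add]
  congr 1
  push_cast
  ring

theorem coeff_rotor (i : ℤ) :
    (rotor n m ρ a b).coeff i = (if i = 0 then (ρ : ℂ) else 0) + ∑ k ∈ Finset.range (m + 1),
      ((harmonic (a ((k : ℤ) * n + 1)) (b ((k : ℤ) * n + 1)) ((k : ℤ) * n + 1)).coeff i
        + (harmonic (a ((k : ℤ) * n - 1)) (b ((k : ℤ) * n - 1)) ((k : ℤ) * n - 1)).coeff i) := by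
  rw [rotor, AddMonoidAlgebra.coeff_add, Finsupp.add_apply, C_apply, AddMonoidAlgebra.coeff_sum,
    Finsupp.finsetSum_apply]
  simp only [AddMonoidAlgebra.coeff_add, Finsupp.add_apply]

theorem rotor_mem_bounded : rotor n m ρ a b ∈ bounded (n * m + 1) := by
  rw [mem_bounded]
  intro i hi
  push_cast at hi
  rw [lt_abs] at hi
  have hnm : 0 ≤ (n : ℤ) * m := by positivity
  rw [coeff_rotor, if_neg (by omega), zero_add]
  refine Finset.sum_eq_zero fun k hk => ?_
  have hk' : (k : ℤ) * n ≤ n * m := by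
    rw [mul_comm]
    exact_mod_cast Nat.mul_le_mul_left n (Nat.le_of_lt_succ (Finset.mem_range.1 hk))
  have hk0 : 0 ≤ (k : ℤ) * n := by positivity
  rw [coeff_harmonic_of_ne (by omega) (by omega), coeff_harmonic_of_ne (by omega) (by omega),
    add_zero]

/-- No harmonic has order zero, since `k n = 1` is impossible for `n ≥ 3`; the mean is therefore the
apothem. -/
theorem coeff_zero_rotor (hn : 3 ≤ n) : (rotor n m ρ a b).coeff 0 = ρ := by
  rw [coeff_rotor, if_pos rfl, Finset.sum_eq_zero, add_zero]
  intro k _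
  have hk : (k : ℤ) * n + 1 ≠ 0 := by positivity
  have hk' : (k : ℤ) * n - 1 ≠ 0 := by
    intro h
    have : (n : ℤ) ∣ 1 := Dvd.intro_left (k : ℤ) (by linarith)
    have := Int.le_of_dvd one_pos this
    omega
  rw [coeff_harmonic_of_ne hk (neg_ne_zero.2 hk), coeff_harmonic_of_ne hk' (neg_ne_zero.2 hk'),
    add_zero]

theorem coeff_top_rotor (hn : 3 ≤ n) (hm : m ≠ 0)
    (htop : a ((n : ℤ) * m + 1) ≠ 0 ∨ b ((n : ℤ) * m + 1) ≠ 0) :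
    (rotor n m ρ a b).coeff ((n * m + 1 : ℕ) : ℤ) ≠ 0 ∧
      (rotor n m ρ a b).coeff (-((n * m + 1 : ℕ) : ℤ)) ≠ 0 := by
  have hnm : (3 : ℤ) ≤ n * m := by
    exact_mod_cast hn.trans (Nat.le_mul_of_pos_right n (Nat.pos_of_ne_zero hm))
  -- A gap of at least `3` keeps `k n + 1` below `n m + 1` for `k < m`, so a single harmonic reaches
  -- the extreme exponents.
  have hlt : ∀ k ∈ Finset.range (m + 1), k ≠ m → (k : ℤ) * n + 3 ≤ n * m := by
    intro k hk hkm
    have h1 : k + 1 ≤ m := by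
      have := Finset.mem_range.1 hk
      omega
    have h2 : (n * (k + 1) : ℤ) ≤ n * m := by exact_mod_cast Nat.mul_le_mul_left n h1
    have h3 : (3 : ℤ) ≤ n := by exact_mod_cast hn
    linarith [mul_comm (k : ℤ) n, mul_add (n : ℤ) k 1]
  have hmem : m ∈ Finset.range (m + 1) := Finset.self_mem_range_succ m
  have hcomm : (m : ℤ) * n = n * m := mul_comm _ _
  have hne := harmonic_coeff_ne_zero htop
  constructor
  · rw [coeff_rotor, if_neg (by push_cast; omega), zero_add, Finset.sum_eq_single m]
    · rw [hcomm, coeff_harmonic, if_pos (by push_cast; rfl), if_neg (by push_cast; omega),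
        coeff_harmonic_of_ne (by push_cast; omega) (by push_cast; omega), add_zero, add_zero]
      exact hne.1
    · intro k hk hkm
      have h1 := hlt k hk hkm
      have h2 : 0 ≤ (k : ℤ) * n := by positivity
      rw [coeff_harmonic_of_ne (by push_cast; omega) (by push_cast; omega),
        coeff_harmonic_of_ne (by push_cast; omega) (by push_cast; omega), add_zero]
    · exact fun h => absurd hmem h
  · rw [coeff_rotor, if_neg (by push_cast; omega), zero_add, Finset.sum_eq_single m]
    · rw [hcomm, coeff_harmonic, if_neg (by push_cast; omega), if_pos (by push_cast; rfl),
        coeff_harmonic_of_ne (by push_cast; omega) (by push_cast; omega), zero_add, add_zero]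
      exact hne.2
    · intro k hk hkm
      have h1 := hlt k hk hkm
      have h2 : 0 ≤ (k : ℤ) * n := by positivity
      rw [coeff_harmonic_of_ne (by push_cast; omega) (by push_cast; omega),
        coeff_harmonic_of_ne (by push_cast; omega) (by push_cast; omega), add_zero]
    · exact fun h => absurd hmem h

end LaurentPolynomial

/-- A support function without harmonics of order greater than one belongs to a circle. -/
theorem isCircle_supportCurve_rotorSupport_zero {n : ℕ} {ρ : ℝ} (hρ : 0 < ρ) (a b : ℤ → ℝ) :
    IsCircle (supportCurve (rotorSupport n 0 ρ a b)) := by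
  set α := a 1 + a (-1) with hα
  -- For `k = 0` the order `k n - 1` is `-1`; the odd sine produces the minus sign, the even cosine
  -- the plus sign in `α`.
  set β := b 1 - b (-1) with hβ
  have hp : rotorSupport n 0 ρ a b = fun θ => ρ + (α * Real.cos θ + β * Real.sin θ) := by
    ext θ
    simp [rotorSupport, hα, hβ]
    ring
  have hd : ∀ θ, deriv (rotorSupport n 0 ρ a b) θ = -α * Real.sin θ + β * Real.cos θ := by
    intro θ
    rw [hp]
    exact ((((Real.hasDerivAt_cos θ).const_mul α).add
      ((Real.hasDerivAt_sin θ).const_mul β)).const_add ρ).deriv.trans (by ring)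
  have hγ : ∀ θ, supportParam (rotorSupport n 0 ρ a b) θ
      = ![α + ρ * Real.cos θ, β + ρ * Real.sin θ] := by
    intro θ
    have h := Real.sin_sq_add_cos_sq θ
    rw [supportParam, hd, hp]
    ext i
    fin_cases i
    · simp
      linear_combination α * h
    · simp
      linear_combination β * h
  refine ⟨![α, β], ρ, hρ, ?_⟩
  ext P
  constructor
  · rintro ⟨θ, -, rfl⟩
    rw [hγ]
    simp
    linear_combination ρ ^ 2 * Real.sin_sq_add_cos_sq θ
  · intro hP
    simp only [Set.mem_ofPred_eq, Matrix.cons_val_zero, Matrix.cons_val_one] at hP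
    set z : ℂ := ⟨P 0 - α, P 1 - β⟩ with hz
    have hnorm : ‖z‖ = ρ := by
      rw [Complex.norm_eq_sqrt_sq_add_sq, hP, Real.sqrt_sq hρ.le]
    -- The support angle of a point on the circle is the argument of its displacement from the
    -- centre.
    refine ⟨z.arg, ⟨(Complex.neg_pi_lt_arg z).le, Complex.arg_le_pi z⟩, ?_⟩
    rw [hγ, ← hnorm, Complex.norm_mul_cos_arg, Complex.norm_mul_sin_arg]
    ext i
    fin_cases i <;> simp [hz]

end

/-! ### The degree of algebraic rotors -/

theorem theorem2p3 (n m : ℕ) (ρ : ℝ) (a b : ℤ → ℝ) (C : Set (Fin 2 → ℝ))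
    (hC : IsAlgebraicRotor n m ρ a b C) (hcirc : ¬ IsCircle C)
    (htop : a ((n : ℤ) * m + 1) ≠ 0 ∨ b ((n : ℤ) * m + 1) ≠ 0) :
    (∃ f : MvPolynomial (Fin 2) ℝ, IsDefiningPolynomial C f) ∧
      ∀ f : MvPolynomial (Fin 2) ℝ, IsDefiningPolynomial C f →
        f.totalDegree = 2 * n * m + 4 ∧
        f.degreeOf 0 = 2 * n * m + 4 ∧
        f.degreeOf 1 = 2 * n * m + 4 := by
  have hn := hC.three_le
  have hcurve := hC.curve_eq
  subst hcurve
  have hm : m ≠ 0 := by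
    rintro rfl
    exact hcirc (isCircle_supportCurve_rotorSupport_zero hC.apothem_pos a b)
  have hN : 2 ≤ n * m + 1 := by
    have := Nat.mul_pos (show 0 < n by omega) (Nat.pos_of_ne_zero hm)
    omega
  obtain ⟨h1, h2⟩ := LaurentPolynomial.coeff_top_rotor (ρ := ρ) hn hm htop
  have h := isDefiningPolynomial_supportCurve hN
    (fun θ => (LaurentPolynomial.evalCircle_rotor θ).symm)
    LaurentPolynomial.rotor_mem_bounded h1 h2
    (by rw [LaurentPolynomial.coeff_zero_rotor hn]; exact_mod_cast hC.apothem_pos.ne')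
  rwa [show 2 * n * m + 4 = 2 * (n * m + 1 + 1) by ring]
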